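/- Let $\mathbb{S}$ be a commutative semigroup, written multiplicatively, with identity $e$, and let $\mathbb{S}'$ be the set of all non-zero functions $\gamma:\mathbb{S}\to\mathbb{C}$ with $\gamma(st)=\gamma(s)\gamma(t)$ for all $s,t\in\mathbb{S}$. *BV-functions.* For $(a,b)\in\mathbb{S}\times\mathbb{S}$ let $E_{(a,b)}$ be the shift operator on functions $f:\mathbb{S}\times\mathbb{S}\to\mathbb{C}$, $(E_{(a,b)}f)(s,t)=f(as,bt)$; let $I=E_{(e,e)}$, and let $\mathcal{A}(\mathbb{S})$ be the complex span of all shift operators, a commutative algebra with involution $\bigl(\sum\alpha_{(a,b)}E_{(a,b)}\bigr)^*=\sum\overline{\alpha_{(a,b)}}\,E_{(b,a)}$. For $\tau\subset\mathcal{A}(\mathbb{S})$ let $\mathcal{P}_\tau$ be the convex cone of all non-negative linear combinations of finite (possibly empty) products of elements of $\tau$. The set $\tau$ is *admissible* if (1) $T^*=T$ for each $T\in\tau$; (2) $I-T\in\mathcal{P}_\tau$ for each $T\in\tau$; (3) $\mathcal{A}(\mathbb{S})$ is the complex linear span of the finite products of elements of $\tau$. Let $\tau$ be admissible and let $\Omega$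 be a collection of finite families $\Lambda$ (counted with multiplicity) of elements of $\mathcal{P}_\tau$ such that $\sum_{T\in\Lambda}T=I$ for all $\Lambda\in\Omega$; such that $\Lambda\Lambda':=\{TT':(T,T')\in\Lambda\times\Lambda'\}\in\Omega$ for all $\Lambda,\Lambda'\in\Omega$; and such that each element of $\tau$ belongs to some $\Lambda\in\Omega$. Order $\Omega$ by $\Lambda_1\le\Lambda_2$ iff $\Lambda_2=\Lambda_3\Lambda_1$ for some $\Lambda_3\in\Omega$, and put $\|f\|_\Lambda=\sum_{T\in\Lambda}|(Tf)(e,e)|$. A function $f:\mathbb{S}\times\mathbb{S}\to\mathbb{C}$ is a *BV-function in the sense of Maserick* if, for some such $\tau$ and $\Omega$, the net $(\|f\|_\Lambda)_{\Lambda\in\Omega}$ has a finite limit. **Statement.** Let $f:\mathbb{S}\times\mathbb{S}\to\mathbb{C}$ be a BV-function in the sense of Maserick such that $f(e,e)\neq 0$. Then $$f(e,e)\,f(s,t)=f(s,e)\,f(e,t)\qquad\text{for all }s,t\in\mathbb{S}$$ if and only if there are a constant $c\in\mathbb{C}\setminus\{0\}$ and a function $\gamma\in\mathbb{S}'$ such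 that $$f(s,t)=c\,\gamma(s)\,\overline{\gamma(t)}\qquad\text{for all }s,t\in\mathbb{S}.$$ -/

import Mathlib

open scoped ComplexConjugate

/-- The functions `S × S → ℂ`. -/
abbrev PairFun (S : Type*) : Type _ := S × S → ℂ

/-- The linear operators on the space of all functions `S × S → ℂ`. -/
abbrev PairOp (S : Type*) : Type _ := Module.End ℂ (PairFun S)

/-- The set `S'` of non-zero multiplicative functions `S → ℂ`. -/
def multiplicativeFunctions (S : Type*) [CommMonoid S] : Set (S → ℂ) :=
  {ϱ | ϱ ≠ 0 ∧ ∀ s t : S, ϱ (s * t) = ϱ s * ϱ t}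

/-- The shift operator `E_(a,b)`, given by `(E_(a,b) f)(s,t) = f(as, bt)`. -/
def shiftOp {S : Type*} [CommMonoid S] (a : S × S) : PairOp S where
  toFun f := fun p => f (a.1 * p.1, a.2 * p.2)
  map_add' _ _ := rfl
  map_smul' _ _ := rfl

/-- The algebra of shifts: the complex span of all shift operators. -/
def shiftAlgebra (S : Type*) [CommMonoid S] : Submodule ℂ (PairOp S) :=
  Submodule.span ℂ (Set.range (shiftOp (S := S)))

/-- The involution `T ↦ T*`. It is written as conjugation by the antilinear map `J`,
`(J f)(s,t) = conj (f(t,s))`; by `involOp_sum_shiftOp` below, on the algebra of shifts it is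
`(∑ α_(a,b) E_(a,b))* = ∑ conj α_(a,b) E_(b,a)`. -/
def involOp {S : Type*} (T : PairOp S) : PairOp S where
  toFun f := fun p => conj (T (fun q => conj (f q.swap)) p.swap)
  map_add' f g := by
    have h : (fun q : S × S => conj ((f + g) q.swap)) =
        (fun q : S × S => conj (f q.swap)) + fun q : S × S => conj (g q.swap) := by
      funext q; simp
    funext p
    change conj (T (fun q : S × S => conj ((f + g) q.swap)) p.swap) = _
    rw [h, map_add, Pi.add_apply, map_add]
    rfl
  map_smul' c f := by
    have h : (fun q : S × S => conj ((c • f) q.swap)) =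
        (conj c) • fun q : S × S => conj (f q.swap) := by
      funext q; simp
    funext p
    change conj (T (fun q : S × S => conj ((c • f) q.swap)) p.swap) = _
    rw [h, map_smul, Pi.smul_apply, smul_eq_mul, map_mul, Complex.conj_conj]
    rfl

theorem involOp_sum_shiftOp {S : Type*} [CommMonoid S] {ι : Type*} (s : Finset ι)
    (α : ι → ℂ) (a : ι → S × S) :
    involOp (∑ i ∈ s, α i • shiftOp (a i)) = ∑ i ∈ s, conj (α i) • shiftOp (a i).swap := by
  refine LinearMap.ext fun f => funext fun p => ?_
  simp [involOp, shiftOp, LinearMap.sum_apply, Finset.sum_apply]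

/-- The convex cone `P_τ` of all non-negative linear combinations of finite products of
elements of `τ`. -/
def positiveCone {S : Type*} (τ : Set (PairOp S)) : Set (PairOp S) :=
  (Submodule.span NNReal (Submonoid.closure τ : Set (PairOp S)) : Set (PairOp S))

/-- Admissible subsets of the algebra of shifts, in the sense of Maserick. -/
structure IsAdmissible {S : Type*} [CommMonoid S] (τ : Set (PairOp S)) : Prop where
  subset_shiftAlgebra : ∀ T ∈ τ, T ∈ shiftAlgebra S
  invol_eq : ∀ T ∈ τ, involOp T = T
  one_sub_mem : ∀ T ∈ τ, 1 - T ∈ positiveCone τ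
  span_eq : Submodule.span ℂ (Submonoid.closure τ : Set (PairOp S)) = shiftAlgebra S

/-- The product `Λ Λ' = {T T' : (T, T') ∈ Λ × Λ'}` of two finite families of operators;
families are counted with multiplicity. -/
def familyMul {S : Type*} (Λ Λ' : Multiset (PairOp S)) : Multiset (PairOp S) :=
  (Λ ×ˢ Λ').map fun p => p.1 * p.2

/-- A collection `Ω` of finite partitions of the identity into members of `P_τ` that is closed
under products and whose members cover `τ`. -/
structure IsPartitionSystem {S : Type*} (τ : Set (PairOp S))
    (Ω : Set (Multiset (PairOp S))) : Prop where
  mem_cone : ∀ Λ ∈ Ω, ∀ T ∈ Λ, T ∈ positiveCone τ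
  sum_eq_one : ∀ Λ ∈ Ω, Λ.sum = 1
  mul_mem : ∀ Λ ∈ Ω, ∀ Λ' ∈ Ω, familyMul Λ Λ' ∈ Ω
  cover : ∀ T ∈ τ, ∃ Λ ∈ Ω, T ∈ Λ

/-- The refinement order on `Ω`: `Λ₁ ≤ Λ₂` iff `Λ₂ = Λ₃ Λ₁` for some `Λ₃ ∈ Ω`. -/
def Refines {S : Type*} (Ω : Set (Multiset (PairOp S))) (Λ₁ Λ₂ : Multiset (PairOp S)) : Prop :=
  ∃ Λ₃ ∈ Ω, Λ₂ = familyMul Λ₃ Λ₁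

/-- The variation `‖f‖_Λ = ∑_{T ∈ Λ} |(T f)(e,e)|`. -/
noncomputable def familyVariation {S : Type*} [CommMonoid S] (f : PairFun S)
    (Λ : Multiset (PairOp S)) : ℝ :=
  (Λ.map fun T => ‖T f (1, 1)‖).sum

/-- `f` is a BV-function in the sense of Maserick: for some admissible `τ` and some partition
system `Ω` for `τ`, the net `(‖f‖_Λ)`, `Λ ∈ Ω`, has a finite limit along refinement. -/
def IsMaserickBV {S : Type*} [CommMonoid S] (f : PairFun S) : Prop :=
  ∃ (τ : Set (PairOp S)) (Ω : Set (Multiset (PairOp S))),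
    IsAdmissible τ ∧ IsPartitionSystem τ Ω ∧
      ∃ L : ℝ, ∀ ε > 0, ∃ Λ₀ ∈ Ω, ∀ Λ ∈ Ω, Refines Ω Λ₀ Λ → |familyVariation f Λ - L| < ε

/-!
The substance of the theorem is that the product formula makes the normalized function
`f / f(e,e)` a character of `S × S` satisfying `χ(e,t) = conj χ(t,e)`. The functional
`L(T) = (T f)(e,e)` on the algebra of shifts is, morally, integration against a complex measure on
the `*`-characters of that algebra, and the product formula says that its matrix of moments
`L(E_(s,e) E_(e,t))` has rank one. The rank-one case of Luecking's theorem on finite-rank Toeplitz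
operators says that such a measure is a multiple of a point mass.

No representing measure is constructed. Bounded variation bounds `∑_w |L(r_w)|` over all words `w`
in a partition of unity `r ∈ Ω`, uniformly in the length of the words, and any two shifts
`E_(s,e)`, `E_(t,e)` are polynomials in a common such partition (`exists_partition_polynomials`).
The multivariate Bernstein sums `∑_w L(r_w) g(freq w)` are therefore integrals against complex
measures of bounded total variation on a cube, and they converge to `L` on polynomials
(`tendsto_bernsteinSum`).

For the rank-one theorem (`moment_two_mul_eq_sq`), let `z` be the function representing
`p = E_(s,e)`, say, and let `D = z(x) - z(y)`. Rank one makes the integral of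
`D ^ a * conj D ^ b` against the product of the limit functional with itself equal, up to a
constant, to the product of the integrals of `D ^ a` and of `conj D ^ b`; for odd `a` the former is
zero by antisymmetry. Since `D ^ 2` is a uniform limit of combinations of
`D ^ (3 + 2 k) * conj D ^ (1 + 2 k)`, its integral `2 (L(p ^ 2) L(1) - L(p) ^ 2)` vanishes as well.
Polarization in `p` shows that `f(·,e)` and `f(e,·)` are multiplicative up to the factor `f(e,e)`.

Finally, if `L` is `f(e,e)` times a character `χ`, then bounded variation along words reads
`|f(e,e)| (∑ i, |χ(r i)|) ^ N ≤ C` for all `N`, so `∑ i, |χ(r i)| ≤ 1 = ∑ i, χ(r i)` and every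
`χ(r i)` is real. As the adjoint of a polynomial in `r` has the conjugate coefficients, `χ`
respects the involution, which is the conjugacy of the two marginals.
-/

open Filter Topology

/-! ### Bernstein sums of functionals of bounded variation -/

section Bernstein

variable {ι : Type*}

/-- The value of a complex polynomial at a real point. -/
noncomputable def realEval (P : MvPolynomial ι ℂ) (x : ι → ℝ) : ℂ :=
  MvPolynomial.eval (fun i => (x i : ℂ)) P

theorem continuous_realEval (P : MvPolynomial ι ℂ) : Continuous (realEval P) :=
  (MvPolynomial.continuous_eval P).comp (by fun_prop)

/-- The frequency vector of a word `w`: the proportion of the places at which each letter occurs.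
It is `0` for the empty word. -/
noncomputable def letterFreq [DecidableEq ι] {N : ℕ} (w : Fin N → ι) : ι → ℝ :=
  fun i => (∑ j, if w j = i then 1 else 0) / N

theorem letterFreq_mem_cube [DecidableEq ι] {N : ℕ} (w : Fin N → ι) :
    letterFreq w ∈ Set.Icc (0 : ι → ℝ) 1 := by
  constructor
  · intro i
    exact div_nonneg (Finset.sum_nonneg fun j _ => by split_ifs <;> norm_num) (Nat.cast_nonneg _)
  · intro i
    refine div_le_one_of_le₀ ?_ (Nat.cast_nonneg _)
    calc (∑ j, if w j = i then (1 : ℝ) else 0) ≤ ∑ _j : Fin N, (1 : ℝ) :=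
          Finset.sum_le_sum fun j _ => by split_ifs <;> norm_num
      _ = N := by simp

variable [Fintype ι] {A : Type*} [CommRing A] [Algebra ℂ A]

/-- `L` has variation at most `C` along the powers of the family `r`: the values of `L` on the
products `r_w = r_(w 0) ⋯ r_(w (N-1))`, over all words `w` of length `N`, sum to at most `C` in
absolute value, for every `N`. -/
def HasWordVariationLE (L : A →ₗ[ℂ] ℂ) (r : ι → A) (C : ℝ) : Prop :=
  ∀ N : ℕ, ∑ w : Fin N → ι, ‖L (∏ j, r (w j))‖ ≤ C

/-- The functional `x ↦ L (a x)`. -/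
def mulFunctional (L : A →ₗ[ℂ] ℂ) (a : A) : A →ₗ[ℂ] ℂ := L ∘ₗ LinearMap.mulLeft ℂ a

theorem HasWordVariationLE.mulFunctional {L : A →ₗ[ℂ] ℂ} {r : ι → A} {C : ℝ}
    (hL : HasWordVariationLE L r C) (i : ι) : HasWordVariationLE (mulFunctional L (r i)) r C := by
  intro N
  refine le_trans ?_ (hL (N + 1))
  rw [← (Fin.consEquiv fun _ => ι).sum_comp, Fintype.sum_prod_type]
  refine le_trans (le_of_eq ?_) (Finset.single_le_sum
    (f := fun k => ∑ w : Fin N → ι, ‖L (∏ j, r (Fin.consEquiv (fun _ => ι) (k, w) j))‖)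
    (fun k _ => Finset.sum_nonneg fun w _ => norm_nonneg _) (Finset.mem_univ i))
  simp [_root_.mulFunctional, Fin.consEquiv, Fin.prod_univ_succ]

/-- The Bernstein sum `∑_w L(r_w) g(freq w)` over the words `w` of length `N`. It is the integral
of `g` against a finitely supported complex measure on the unit cube. -/
noncomputable def bernsteinSum [DecidableEq ι] (L : A →ₗ[ℂ] ℂ) (r : ι → A) (N : ℕ)
    (g : (ι → ℝ) → ℂ) : ℂ :=
  ∑ w : Fin N → ι, L (∏ j, r (w j)) * g (letterFreq w)

variable [DecidableEq ι]

theorem norm_bernsteinSum_le {L : A →ₗ[ℂ] ℂ} {r : ι → A} {C : ℝ}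
    (hL : HasWordVariationLE L r C) {N : ℕ} {g : (ι → ℝ) → ℂ} {δ : ℝ}
    (hg : ∀ x ∈ Set.Icc (0 : ι → ℝ) 1, ‖g x‖ ≤ δ) : ‖bernsteinSum L r N g‖ ≤ C * δ := by
  have hδ : 0 ≤ δ := (norm_nonneg _).trans (hg 0 (by simp))
  calc ‖bernsteinSum L r N g‖ ≤ ∑ w : Fin N → ι, ‖L (∏ j, r (w j)) * g (letterFreq w)‖ :=
        norm_sum_le _ _
    _ ≤ ∑ w : Fin N → ι, ‖L (∏ j, r (w j))‖ * δ := Finset.sum_le_sum fun w _ => by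
        rw [norm_mul]
        exact mul_le_mul_of_nonneg_left (hg _ (letterFreq_mem_cube w)) (norm_nonneg _)
    _ ≤ C * δ := by
        rw [← Finset.sum_mul]
        exact mul_le_mul_of_nonneg_right (hL N) hδ

/-- Prepending one letter moves the frequency vector by at most `1 / (N + 1)`. -/
theorem dist_letterFreq_cons_le {N : ℕ} (i : ι) (w : Fin N → ι) :
    dist (letterFreq (Fin.cons i w : Fin (N + 1) → ι)) (letterFreq w) ≤ 1 / ((N : ℝ) + 1) := by
  have hN : (0 : ℝ) < (N : ℝ) + 1 := by positivity
  refine (dist_pi_le_iff (by positivity)).2 fun k => ?_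
  have h1 := (letterFreq_mem_cube w).2 k
  have h0 := (letterFreq_mem_cube w).1 k
  have hs : (∑ j, if w j = k then (1 : ℝ) else 0) = N * letterFreq w k := by
    rcases Nat.eq_zero_or_pos N with rfl | h
    · simp
    · have : (N : ℝ) ≠ 0 := by positivity
      simp only [letterFreq]
      field_simp
  have hc : letterFreq (Fin.cons i w : Fin (N + 1) → ι) k =
      ((if i = k then 1 else 0) + N * letterFreq w k) / (N + 1) := by
    rw [← hs]
    simp only [letterFreq]
    rw [Fin.sum_univ_succ]
    simp only [Fin.cons_zero, Fin.cons_succ]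
    push_cast
    rfl
  rw [hc, Real.dist_eq]
  have : ((if i = k then 1 else 0) + N * letterFreq w k) / ((N : ℝ) + 1) - letterFreq w k =
      ((if i = k then 1 else 0) - letterFreq w k) / ((N : ℝ) + 1) := by
    field_simp
    ring
  rw [this, abs_div, abs_of_pos hN]
  refine div_le_div_of_nonneg_right ?_ hN.le
  simp only [Pi.zero_apply, Pi.one_apply] at h0 h1
  rw [abs_le]
  split_ifs <;> constructor <;> linarith

/-- Multiplying the integrand by a coordinate amounts to drawing the corresponding letter once:
by exchangeability every one of the `N + 1` places contributes equally. -/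
theorem bernsteinSum_mul_coord (L : A →ₗ[ℂ] ℂ) (r : ι → A) (N : ℕ) (g : (ι → ℝ) → ℂ) (i : ι) :
    bernsteinSum L r (N + 1) (fun x => g x * (x i : ℂ)) =
      ∑ w : Fin N → ι, mulFunctional L (r i) (∏ j, r (w j)) *
        g (letterFreq (Fin.cons i w : Fin (N + 1) → ι)) := by
  have hfreq : ∀ (m : Fin (N + 1)) (w : Fin N → ι),
      letterFreq (m.insertNth i w : Fin (N + 1) → ι) =
        letterFreq (Fin.cons i w : Fin (N + 1) → ι) := by
    intro m w
    funext k
    simp only [letterFreq]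
    rw [Fin.sum_univ_succAbove _ m, Fin.sum_univ_succ]
    simp
  have hplace : ∀ m : Fin (N + 1),
      ∑ w : Fin (N + 1) → ι, L (∏ j, r (w j)) * g (letterFreq w) * (if w m = i then 1 else 0) =
      ∑ w : Fin N → ι, mulFunctional L (r i) (∏ j, r (w j)) *
        g (letterFreq (Fin.cons i w : Fin (N + 1) → ι)) := by
    intro m
    rw [← (Fin.insertNthEquiv (fun _ => ι) m).sum_comp, Fintype.sum_prod_type]
    rw [Finset.sum_eq_single i]
    · refine Finset.sum_congr rfl fun w _ => ?_
      change L (∏ j, r ((m.insertNth i w : Fin (N + 1) → ι) j)) *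
        g (letterFreq (m.insertNth i w : Fin (N + 1) → ι)) *
          (if (m.insertNth i w : Fin (N + 1) → ι) m = i then 1 else 0) = _
      rw [hfreq, Fin.prod_univ_succAbove _ m]
      simp [mulFunctional]
    · intro k _ hk
      simp [hk]
    · simp
  have hN : ((N : ℂ) + 1) ≠ 0 := by exact_mod_cast Nat.succ_ne_zero N
  calc bernsteinSum L r (N + 1) (fun x => g x * (x i : ℂ))
      = ∑ w : Fin (N + 1) → ι, ∑ m : Fin (N + 1),
          L (∏ j, r (w j)) * g (letterFreq w) * (if w m = i then 1 else 0) / ((N : ℂ) + 1) := by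
        refine Finset.sum_congr rfl fun w _ => ?_
        rw [← Finset.sum_div, ← Finset.mul_sum]
        simp [letterFreq]
        ring
    _ = ∑ m : Fin (N + 1), (∑ w : Fin (N + 1) → ι,
          L (∏ j, r (w j)) * g (letterFreq w) * (if w m = i then 1 else 0)) / ((N : ℂ) + 1) := by
        rw [Finset.sum_comm]
        simp_rw [Finset.sum_div]
    _ = _ := by
        simp_rw [hplace]
        rw [Finset.sum_const, Finset.card_univ, Fintype.card_fin, nsmul_eq_mul]
        push_cast
        field_simp

/-- Bernstein's theorem for functionals of bounded variation: on a polynomial in a partition of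
unity `r`, the functional is the limit of its Bernstein sums. -/
theorem tendsto_bernsteinSum {r : ι → A} (hr : ∑ i, r i = 1) {C : ℝ} (P : MvPolynomial ι ℂ)
    (L : A →ₗ[ℂ] ℂ) (hL : HasWordVariationLE L r C) :
    Tendsto (fun N => bernsteinSum L r N (realEval P)) atTop (𝓝 (L (MvPolynomial.aeval r P))) := by
  induction P using MvPolynomial.induction_on generalizing L with
  | C c =>
    refine tendsto_const_nhds.congr fun N => ?_
    simp only [bernsteinSum, realEval, MvPolynomial.eval_C, MvPolynomial.aeval_C]
    rw [← Finset.sum_mul, ← map_sum, ← Fintype.sum_pow, hr, one_pow, Algebra.algebraMap_eq_smul_one,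
      map_smul, smul_eq_mul, mul_comm]
  | add P Q hP hQ =>
    rw [map_add, map_add]
    refine ((hP L hL).add (hQ L hL)).congr fun N => ?_
    simp [bernsteinSum, realEval, mul_add, Finset.sum_add_distrib]
  | mul_X P i hP =>
    rw [← tendsto_add_atTop_iff_nat 1]
    have hlim := hP _ (hL.mulFunctional i)
    have hval : mulFunctional L (r i) (MvPolynomial.aeval r P) =
        L (MvPolynomial.aeval r (P * MvPolynomial.X i)) := by
      simp [mulFunctional, mul_comm]
    rw [hval] at hlim
    have hcomp : IsCompact (Set.Icc (0 : ι → ℝ) 1) := isCompact_Icc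
    have huc := hcomp.uniformContinuousOn_of_continuous (continuous_realEval P).continuousOn
    have hdiff : Tendsto (fun N => bernsteinSum L r (N + 1) (realEval (P * MvPolynomial.X i)) -
        bernsteinSum (mulFunctional L (r i)) r N (realEval P)) atTop (𝓝 0) := by
      rw [Metric.tendsto_atTop]
      intro ε hε
      have hC : 0 ≤ C := (Finset.sum_nonneg fun w _ => norm_nonneg _).trans (hL 0)
      obtain ⟨δ, hδ, hu⟩ := Metric.uniformContinuousOn_iff_le.1 huc (ε / (C + 1)) (by positivity)
      obtain ⟨N₀, hN₀⟩ := exists_nat_one_div_lt hδ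
      refine ⟨N₀, fun N hN => ?_⟩
      have hmul : realEval (P * MvPolynomial.X i) = fun x => realEval P x * (x i : ℂ) := by
        funext x
        simp [realEval]
      rw [dist_zero_right, hmul, bernsteinSum_mul_coord, bernsteinSum, ← Finset.sum_sub_distrib]
      calc _ ≤ ∑ w : Fin N → ι, ‖mulFunctional L (r i) (∏ j, r (w j))‖ * (ε / (C + 1)) := by
            refine (norm_sum_le _ _).trans (Finset.sum_le_sum fun w _ => ?_)
            rw [← mul_sub, norm_mul]
            refine mul_le_mul_of_nonneg_left ?_ (norm_nonneg _)
            rw [← dist_eq_norm]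
            refine hu _ (letterFreq_mem_cube _) _ (letterFreq_mem_cube _)
              ((dist_letterFreq_cons_le i w).trans ?_)
            refine le_trans ?_ hN₀.le
            exact one_div_le_one_div_of_le (by positivity)
              (by exact_mod_cast Nat.add_le_add_right hN 1)
        _ ≤ C * (ε / (C + 1)) := by
            rw [← Finset.sum_mul]
            exact mul_le_mul_of_nonneg_right (hL.mulFunctional i N) (by positivity)
        _ < ε := by
            rw [mul_div_assoc', div_lt_iff₀ (by positivity)]
            nlinarith
    simpa using hdiff.add hlim

end Bernstein

/-! ### Moments of rank one -/

section RankOne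

/-- On a bounded interval, `t` is a uniform limit of polynomials of the form `t ^ 2 q(t ^ 2)`. -/
theorem exists_polynomial_mul_one_sub_le {Y ε : ℝ} (hε : 0 < ε) :
    ∃ q : Polynomial ℝ, ∀ t ∈ Set.Icc 0 Y, t * |1 - t * q.eval (t ^ 2)| ≤ ε := by
  -- `q(y)` is taken close to `1 / (√y + ε / 2)`.
  have hcont : ContinuousOn (fun y : ℝ => 1 / (√y + ε / 2)) (Set.Icc 0 (Y ^ 2)) := by
    refine ContinuousOn.div continuousOn_const (by fun_prop) fun y _ => ?_
    have := Real.sqrt_nonneg y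
    positivity
  obtain ⟨q, hq⟩ := exists_polynomial_near_of_continuousOn 0 (Y ^ 2) _ hcont
    (ε / (2 * (Y ^ 2 + 1))) (by positivity)
  refine ⟨q, fun t ht => ?_⟩
  have ht0 : 0 ≤ t := ht.1
  have htY : t ^ 2 ≤ Y ^ 2 := by gcongr; exact ht.2
  have h := (hq (t ^ 2) ⟨by positivity, htY⟩).le
  rw [Real.sqrt_sq ht0, abs_sub_comm] at h
  have hsplit : 1 - t * q.eval (t ^ 2) =
      (ε / 2) / (t + ε / 2) + t * (1 / (t + ε / 2) - q.eval (t ^ 2)) := by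
    field_simp
    ring
  have h1 : |1 - t * q.eval (t ^ 2)| ≤ (ε / 2) / (t + ε / 2) + t * (ε / (2 * (Y ^ 2 + 1))) := by
    rw [hsplit]
    refine (abs_add_le _ _).trans (add_le_add (abs_of_nonneg (by positivity)).le ?_)
    rw [abs_mul, abs_of_nonneg ht0]
    exact mul_le_mul_of_nonneg_left h ht0
  have h2 : t * ((ε / 2) / (t + ε / 2)) ≤ ε / 2 := by
    rw [mul_div_assoc', div_le_iff₀ (by positivity)]
    nlinarith
  have h3 : t * (t * (ε / (2 * (Y ^ 2 + 1)))) ≤ ε / 2 := by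
    have : t * (t * (ε / (2 * (Y ^ 2 + 1)))) = (t ^ 2 * ε) / (2 * (Y ^ 2 + 1)) := by ring
    rw [this, div_le_iff₀ (by positivity)]
    nlinarith
  calc t * |1 - t * q.eval (t ^ 2)|
      ≤ t * ((ε / 2) / (t + ε / 2) + t * (ε / (2 * (Y ^ 2 + 1)))) :=
        mul_le_mul_of_nonneg_left h1 ht0
    _ ≤ ε := by rw [mul_add]; linarith

variable {X : Type*}

/-- The product functional `Λ ⊗ Λ` on functions of two variables, as an iterated integral. -/
def doubleFunctional (Λ : (X → ℂ) →ₗ[ℂ] ℂ) : (X → X → ℂ) →ₗ[ℂ] ℂ where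
  toFun G := Λ fun x => Λ (G x)
  map_add' G H := by
    rw [← map_add]
    congr 1
    funext x
    exact map_add Λ (G x) (H x)
  map_smul' c G := by
    rw [RingHom.id_apply, ← map_smul]
    congr 1
    funext x
    exact map_smul Λ c (G x)

theorem doubleFunctional_tensor (Λ : (X → ℂ) →ₗ[ℂ] ℂ) (g h : X → ℂ) :
    doubleFunctional Λ (fun x y => g x * h y) = Λ g * Λ h := by
  have : (fun x => Λ fun y => g x * h y) = Λ h • g := by
    funext x
    rw [show (fun y => g x * h y) = g x • h from rfl, map_smul, Pi.smul_apply, smul_eq_mul,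
      smul_eq_mul, mul_comm]
  rw [doubleFunctional, LinearMap.coe_mk, AddHom.coe_mk, this, map_smul, smul_eq_mul, mul_comm]

/-- The function `(z(x) - z(y)) ^ a` times the conjugate of `(z(x) - z(y)) ^ b`. -/
def diffMonomial (z : X → ℂ) (a b : ℕ) : X → X → ℂ :=
  fun x y => (z x - z y) ^ a * conj (z x - z y) ^ b

/-- The integral of `diffMonomial z a b` against the square of a measure, in terms of the moments
`m j k` of that measure at `z ^ j` times the conjugate of `z ^ k`. -/
noncomputable def diffMoment (m : ℕ → ℕ → ℂ) (a b : ℕ) : ℂ :=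
  ∑ j ∈ Finset.range (a + 1), ∑ k ∈ Finset.range (b + 1),
    ((-1) ^ (a - j) * a.choose j) * ((-1) ^ (b - k) * b.choose k) * (m j k * m (a - j) (b - k))

theorem doubleFunctional_diffMonomial (Λ : (X → ℂ) →ₗ[ℂ] ℂ) (z : X → ℂ) (a b : ℕ) :
    doubleFunctional Λ (diffMonomial z a b) =
      diffMoment (fun j k => Λ fun x => z x ^ j * conj (z x) ^ k) a b := by
  have : diffMonomial z a b = ∑ j ∈ Finset.range (a + 1), ∑ k ∈ Finset.range (b + 1),
      (((-1) ^ (a - j) * a.choose j) * ((-1) ^ (b - k) * b.choose k) : ℂ) •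
        fun x y => (z x ^ j * conj (z x) ^ k) * (z y ^ (a - j) * conj (z y) ^ (b - k)) := by
    funext x y
    simp only [diffMonomial, Finset.sum_apply, Pi.smul_apply, smul_eq_mul, map_sub]
    rw [sub_eq_add_neg (z x), sub_eq_add_neg (conj (z x)), add_pow, add_pow,
      Finset.sum_mul_sum]
    refine Finset.sum_congr rfl fun j _ => Finset.sum_congr rfl fun k _ => ?_
    rw [neg_pow (z y), neg_pow (conj (z y))]
    ring
  rw [this, map_sum]
  refine Finset.sum_congr rfl fun j _ => ?_
  rw [map_sum]
  refine Finset.sum_congr rfl fun k _ => ?_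
  rw [map_smul, smul_eq_mul]
  congr 1
  exact doubleFunctional_tensor Λ (fun x => z x ^ j * conj (z x) ^ k)
    (fun x => z x ^ (a - j) * conj (z x) ^ (b - k))

/-- If the moments have rank one, those of the difference `z(x) - z(y)` factor, and the factor
without conjugates vanishes in odd degree because it is antisymmetric in `x` and `y`. -/
theorem diffMoment_eq_zero_of_odd {m : ℕ → ℕ → ℂ} (hm0 : m 0 0 ≠ 0)
    (hm : ∀ a b, m a b * m 0 0 = m a 0 * m 0 b) {a : ℕ} (ha : Odd a) (b : ℕ) :
    diffMoment m a b = 0 := by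
  set F : ℕ → ℂ := fun j => ((-1) ^ (a - j) * a.choose j) * (m j 0 * m (a - j) 0) with hF
  set G : ℕ → ℂ := fun k => ((-1) ^ (b - k) * b.choose k) * (m 0 k * m 0 (b - k)) with hG
  have hanti : ∑ j ∈ Finset.range (a + 1), F j = 0 := by
    have h : ∑ j ∈ Finset.range (a + 1), F j = -∑ j ∈ Finset.range (a + 1), F j := by
      conv_lhs => rw [← Finset.sum_flip]
      rw [← Finset.sum_neg_distrib]
      refine Finset.sum_congr rfl fun j hj => ?_
      have hja : j ≤ a := Nat.lt_succ_iff.1 (Finset.mem_range.1 hj)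
      have hs : ((-1 : ℂ)) ^ j = -(-1) ^ (a - j) := by
        have h1 : ((-1 : ℂ)) ^ (a - j) * (-1) ^ j = -1 := by
          rw [← pow_add, Nat.sub_add_cancel hja, ha.neg_one_pow]
        have h2 : ((-1 : ℂ)) ^ j * (-1) ^ j = 1 := by rw [← mul_pow]; simp
        have h3 : ((-1 : ℂ)) ^ (a - j) * (-1) ^ (a - j) = 1 := by rw [← mul_pow]; simp
        linear_combination (-(-1 : ℂ) ^ j) * h3 + (-1 : ℂ) ^ (a - j) * h1
      simp only [hF, Nat.sub_sub_self hja, Nat.choose_symm hja, hs]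
      ring
    linear_combination h / 2
  have hprod : diffMoment m a b * m 0 0 ^ 2 =
      (∑ j ∈ Finset.range (a + 1), F j) * ∑ k ∈ Finset.range (b + 1), G k := by
    rw [Finset.sum_mul_sum, diffMoment, Finset.sum_mul]
    refine Finset.sum_congr rfl fun j _ => ?_
    rw [Finset.sum_mul]
    refine Finset.sum_congr rfl fun k _ => ?_
    simp only [hF, hG]
    linear_combination ((-1) ^ (a - j) * a.choose j : ℂ) * ((-1) ^ (b - k) * b.choose k) *
      (m (a - j) (b - k) * m 0 0 * hm j k + m j 0 * m 0 k * hm (a - j) (b - k))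
  rw [hanti, zero_mul] at hprod
  exact (mul_eq_zero.1 hprod).resolve_right (pow_ne_zero 2 hm0)

/-- The rank-one case of Luecking's theorem: if the moments of a bounded function `z` under a
bounded sequence of complex measures converge to moments of rank one, then the limit behaves on
`1`, `z`, `z ^ 2` like a multiple of a point mass. -/
theorem moment_two_mul_eq_sq {K : Set X} {C B : ℝ} {Λ : ℕ → (X → ℂ) →ₗ[ℂ] ℂ}
    (hΛ : ∀ N (g : X → ℂ) δ, 0 ≤ δ → (∀ x ∈ K, ‖g x‖ ≤ δ) → ‖Λ N g‖ ≤ C * δ) {z : X → ℂ}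
    (hz : ∀ x ∈ K, ‖z x‖ ≤ B) {m : ℕ → ℕ → ℂ}
    (hlim : ∀ a b, Tendsto (fun N => Λ N fun x => z x ^ a * conj (z x) ^ b) atTop (𝓝 (m a b)))
    (hm0 : m 0 0 ≠ 0) (hm : ∀ a b, m a b * m 0 0 = m a 0 * m 0 b) :
    m 2 0 * m 0 0 = m 1 0 ^ 2 := by
  have hC : 0 ≤ C := by
    have := (norm_nonneg _).trans (hΛ 0 0 1 zero_le_one fun x _ => by simp)
    linarith
  have hD : ∀ a b, Tendsto (fun N => doubleFunctional (Λ N) (diffMonomial z a b)) atTop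
      (𝓝 (diffMoment m a b)) := by
    intro a b
    simp_rw [doubleFunctional_diffMonomial]
    exact tendsto_finsetSum _ fun j _ => tendsto_finsetSum _ fun k _ =>
      tendsto_const_nhds.mul ((hlim j k).mul (hlim (a - j) (b - k)))
  have hbound : ∀ N (G : X → X → ℂ) δ, 0 ≤ δ → (∀ x ∈ K, ∀ y ∈ K, ‖G x y‖ ≤ δ) →
      ‖doubleFunctional (Λ N) G‖ ≤ C * (C * δ) := fun N G δ hδ hG =>
    hΛ N _ _ (by positivity) fun x hx => hΛ N _ _ hδ fun y hy => hG x hx y hy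
  have hsmall : ∀ ε > 0, ‖diffMoment m 2 0‖ ≤ C * (C * ε) := by
    intro ε hε
    obtain ⟨q, hq⟩ := exists_polynomial_mul_one_sub_le (Y := (2 * B) ^ 2) hε
    -- Subtracting terms with odd exponents, which vanish in the limit, turns `D ^ 2` into the
    -- uniformly small function `D ^ 2 (1 - |D| ^ 2 q(|D| ^ 4))`.
    set G : ℕ → X → X → ℂ := fun k => (q.coeff k : ℂ) • diffMonomial z (3 + 2 * k) (1 + 2 * k)
    have hzero : Tendsto (fun N => doubleFunctional (Λ N)
        (∑ k ∈ Finset.range (q.natDegree + 1), G k)) atTop (𝓝 0) := by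
      have : Tendsto (fun N => ∑ k ∈ Finset.range (q.natDegree + 1), (q.coeff k : ℂ) *
          doubleFunctional (Λ N) (diffMonomial z (3 + 2 * k) (1 + 2 * k))) atTop
          (𝓝 (∑ k ∈ Finset.range (q.natDegree + 1), (q.coeff k : ℂ) * 0)) := by
        refine tendsto_finsetSum _ fun k _ => tendsto_const_nhds.mul ?_
        rw [← diffMoment_eq_zero_of_odd hm0 hm (a := 3 + 2 * k) ⟨k + 1, by omega⟩ (1 + 2 * k)]
        exact hD _ _
      simpa [G, map_sum] using this
    have hlim2 := (hD 2 0).sub hzero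
    rw [sub_zero] at hlim2
    refine le_of_tendsto hlim2.norm (Eventually.of_forall fun N => ?_)
    rw [← map_sub]
    refine hbound N _ ε hε.le fun x hx y hy => ?_
    set D : ℂ := z x - z y with hDdef
    have hDB : ‖D‖ ≤ 2 * B :=
      (norm_sub_le _ _).trans (by linarith [hz x hx, hz y hy])
    have hsum : (∑ k ∈ Finset.range (q.natDegree + 1), G k) x y =
        D ^ 2 * ((‖D‖ ^ 2 * q.eval ((‖D‖ ^ 2) ^ 2) : ℝ) : ℂ) := by
      rw [Polynomial.eval_eq_sum_range]
      push_cast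
      rw [Finset.mul_sum, Finset.mul_sum, Finset.sum_apply, Finset.sum_apply]
      refine Finset.sum_congr rfl fun k _ => ?_
      simp only [G, Pi.smul_apply, smul_eq_mul, diffMonomial, ← hDdef]
      rw [← Complex.mul_conj', ← pow_mul, mul_pow, pow_add, pow_add]
      ring
    rw [Pi.sub_apply, Pi.sub_apply, hsum]
    have hfac : diffMonomial z 2 0 x y - D ^ 2 * ((‖D‖ ^ 2 * q.eval ((‖D‖ ^ 2) ^ 2) : ℝ) : ℂ) =
        D ^ 2 * ((1 - ‖D‖ ^ 2 * q.eval ((‖D‖ ^ 2) ^ 2) : ℝ) : ℂ) := by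
      simp only [diffMonomial, ← hDdef]
      push_cast
      ring
    rw [hfac, norm_mul, norm_pow, Complex.norm_real, Real.norm_eq_abs]
    exact hq _ ⟨by positivity, by gcongr⟩
  have h0 : diffMoment m 2 0 = 0 := by
    rw [← norm_le_zero_iff]
    refine le_of_forall_pos_le_add fun ε hε => ?_
    refine (hsmall (ε / (C ^ 2 + 1)) (by positivity)).trans ?_
    rw [zero_add, mul_div_assoc', mul_div_assoc', div_le_iff₀ (by positivity)]
    nlinarith
  simp [diffMoment, Finset.sum_range_succ] at h0
  linear_combination h0 / 2

end RankOne

/-! ### Shift operators and their involution -/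

section Involution

variable {S : Type*}

theorem involOp_add (T T' : PairOp S) : involOp (T + T') = involOp T + involOp T' := by
  ext f p
  simp [involOp]

theorem involOp_smul (c : ℂ) (T : PairOp S) : involOp (c • T) = conj c • involOp T := by
  ext f p
  simp [involOp]

theorem involOp_mul (T T' : PairOp S) : involOp (T * T') = involOp T * involOp T' := by
  ext f p
  simp [involOp]

theorem involOp_one : involOp (1 : PairOp S) = 1 := by
  ext f p
  simp [involOp]

theorem involOp_shiftOp [CommMonoid S] (a : S × S) : involOp (shiftOp a) = shiftOp a.swap := by
  ext f p
  simp [involOp, shiftOp]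

theorem nnreal_smul_pairOp (c : NNReal) (T : PairOp S) : c • T = ((c : ℝ) : ℂ) • T := by
  ext f p
  simp [NNReal.smul_def]

theorem involOp_eq_of_mem_positiveCone {τ : Set (PairOp S)} (hτ : ∀ T ∈ τ, involOp T = T)
    {T : PairOp S} (hT : T ∈ positiveCone τ) : involOp T = T := by
  refine Submodule.span_induction (p := fun T _ => involOp T = T) ?_ ?_ ?_ ?_ hT
  · intro U hU
    refine Submonoid.closure_induction (motive := fun U _ => involOp U = U) hτ involOp_one ?_ hU
    intro U V _ _ hU hV
    rw [involOp_mul, hU, hV]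
  · simpa using involOp_smul 0 (0 : PairOp S)
  · intro U V _ _ hU hV
    rw [involOp_add, hU, hV]
  · intro c U _ hU
    rw [nnreal_smul_pairOp, involOp_smul, hU, Complex.conj_ofReal]

theorem mem_span_closure_of_mem_positiveCone {τ : Set (PairOp S)} {T : PairOp S}
    (hT : T ∈ positiveCone τ) :
    T ∈ Submodule.span ℂ (Submonoid.closure τ : Set (PairOp S)) := by
  refine Submodule.span_induction
    (p := fun T _ => T ∈ Submodule.span ℂ (Submonoid.closure τ : Set (PairOp S)))
    (fun U hU => Submodule.subset_span hU) (zero_mem _) (fun U V _ _ hU hV => add_mem hU hV) ?_ hT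
  intro c U _ hU
  rw [nnreal_smul_pairOp]
  exact Submodule.smul_mem _ _ hU

end Involution

section ShiftRepresentation

variable {S : Type*} [CommMonoid S]

theorem shiftOp_mul (a b : S × S) : shiftOp (a * b) = shiftOp a * shiftOp b := by
  ext f p
  simp [shiftOp, mul_assoc, mul_left_comm]

theorem shiftOp_one : shiftOp (1 : S × S) = 1 := by
  ext f p
  simp [shiftOp]

/-- The representation of the monoid algebra of `S × S` by shift operators. -/
noncomputable def shiftRep (S : Type*) [CommMonoid S] :
    MonoidAlgebra ℂ (S × S) →ₐ[ℂ] PairOp S :=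
  MonoidAlgebra.lift ℂ (PairOp S) (S × S)
    { toFun := shiftOp
      map_one' := shiftOp_one
      map_mul' := shiftOp_mul }

theorem shiftRep_of (a : S × S) : shiftRep S (MonoidAlgebra.of ℂ _ a) = shiftOp a := by
  rw [shiftRep, MonoidAlgebra.lift_of]
  rfl

theorem shiftRep_injective : Function.Injective (shiftRep S) := by
  classical
  -- Evaluating at the identity the operator applied to an indicator function reads off a
  -- coefficient.
  have hcoeff : ∀ (x : MonoidAlgebra ℂ (S × S)) (a : S × S),
      shiftRep S x (Pi.single a 1) (1, 1) = x.coeff a := by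
    intro x a
    refine MonoidAlgebra.induction_on
      (motive := fun x => shiftRep S x (Pi.single a 1) (1, 1) = x.coeff a) x ?_ ?_ ?_
    · intro b
      rw [shiftRep_of]
      simp [shiftOp, MonoidAlgebra.of_apply, Pi.single_apply, Finsupp.single_apply, eq_comm]
    · intro x y hx hy
      simp [hx, hy]
    · intro c x hx
      simp [hx]
  intro x y hxy
  ext a
  rw [← hcoeff, ← hcoeff, hxy]

theorem mem_range_shiftRep {T : PairOp S} (hT : T ∈ shiftAlgebra S) : ∃ x, shiftRep S x = T := by
  have : shiftAlgebra S ≤ LinearMap.range (shiftRep S).toLinearMap := by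
    refine Submodule.span_le.2 ?_
    rintro _ ⟨a, rfl⟩
    exact ⟨_, shiftRep_of a⟩
  exact this hT

/-- The functional `T ↦ (T f)(e,e)`, on the monoid algebra. -/
noncomputable def evalFunctional (f : PairFun S) : MonoidAlgebra ℂ (S × S) →ₗ[ℂ] ℂ where
  toFun x := shiftRep S x f (1, 1)
  map_add' x y := by simp
  map_smul' c x := by simp

theorem evalFunctional_of (f : PairFun S) (a : S × S) :
    evalFunctional f (MonoidAlgebra.of ℂ _ a) = f a := by
  change shiftRep S _ f (1, 1) = _
  rw [shiftRep_of]
  simp [shiftOp]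

theorem evalFunctional_one (f : PairFun S) : evalFunctional f 1 = f (1, 1) := by
  rw [← map_one (MonoidAlgebra.of ℂ (S × S)), evalFunctional_of]
  rfl

/-- The inclusion of the algebra of holomorphic polynomials: the shifts `E_(s,e)`. -/
noncomputable def leftAlg (S : Type*) [CommMonoid S] :
    MonoidAlgebra ℂ S →ₐ[ℂ] MonoidAlgebra ℂ (S × S) :=
  MonoidAlgebra.lift ℂ _ S ((MonoidAlgebra.of ℂ (S × S)).comp (MonoidHom.inl S S))

/-- The inclusion of the algebra of antiholomorphic polynomials: the shifts `E_(e,t)`. -/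
noncomputable def rightAlg (S : Type*) [CommMonoid S] :
    MonoidAlgebra ℂ S →ₐ[ℂ] MonoidAlgebra ℂ (S × S) :=
  MonoidAlgebra.lift ℂ _ S ((MonoidAlgebra.of ℂ (S × S)).comp (MonoidHom.inr S S))

theorem leftAlg_of (s : S) :
    leftAlg S (MonoidAlgebra.of ℂ _ s) = MonoidAlgebra.of ℂ (S × S) (s, 1) := by
  rw [leftAlg, MonoidAlgebra.lift_of]
  rfl

theorem rightAlg_of (t : S) :
    rightAlg S (MonoidAlgebra.of ℂ _ t) = MonoidAlgebra.of ℂ (S × S) (1, t) := by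
  rw [rightAlg, MonoidAlgebra.lift_of]
  rfl

/-- The product formula for `f` extends bilinearly. -/
theorem evalFunctional_left_mul_right {f : PairFun S}
    (hf : ∀ s t : S, f (1, 1) * f (s, t) = f (s, 1) * f (1, t)) (x y : MonoidAlgebra ℂ S) :
    evalFunctional f (leftAlg S x * rightAlg S y) * evalFunctional f 1 =
      evalFunctional f (leftAlg S x) * evalFunctional f (rightAlg S y) := by
  have h1 := evalFunctional_one f
  induction x using MonoidAlgebra.induction_on with
  | of s =>
    induction y using MonoidAlgebra.induction_on with
    | of t =>
      rw [leftAlg_of, rightAlg_of, ← map_mul (MonoidAlgebra.of ℂ (S × S)), evalFunctional_of,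
        evalFunctional_of, evalFunctional_of, h1, Prod.mk_mul_mk, mul_one, one_mul, mul_comm, hf]
    | add x y hx hy => simp only [map_add, mul_add, add_mul, hx, hy]
    | smul c x hx =>
      simp only [map_smul, mul_smul_comm, smul_eq_mul]
      linear_combination c * hx
  | add x y hx hy => simp only [map_add, add_mul, hx, hy]
  | smul c x hx =>
    simp only [map_smul, smul_mul_assoc, smul_eq_mul]
    linear_combination c * hx

end ShiftRepresentation

/-! ### Partitions of unity and bounded variation -/

section Partitions

variable {S : Type*}

theorem familyMul_map {ι κ : Type*} [Fintype ι] [Fintype κ] (R : ι → PairOp S)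
    (R' : κ → PairOp S) :
    familyMul (Finset.univ.val.map R) (Finset.univ.val.map R') =
      Finset.univ.val.map fun p : ι × κ => R p.1 * R' p.2 := by
  rw [← Finset.univ_product_univ, Finset.product_val]
  simp [familyMul, SProd.sprod, Multiset.product, Multiset.map_bind, Multiset.bind_map]

theorem exists_eq_map_univ (Λ : Multiset (PairOp S)) :
    ∃ (n : ℕ) (R : Fin n → PairOp S), Λ = Finset.univ.val.map R := by
  induction Λ using Quotient.inductionOn with
  | h l => exact ⟨l.length, l.get, by rw [Fin.univ_val_map, List.ofFn_get]; rfl⟩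

theorem sum_map_univ {ι : Type*} [Fintype ι] (R : ι → PairOp S) :
    (Finset.univ.val.map R).sum = ∑ i, R i := rfl

theorem adjoin_le_adjoin_familyMul_left {Λ Λ' : Multiset (PairOp S)} (h' : Λ'.sum = 1) :
    Algebra.adjoin ℂ {T | T ∈ Λ} ≤ Algebra.adjoin ℂ {T | T ∈ familyMul Λ Λ'} := by
  refine Algebra.adjoin_le fun T (hT : T ∈ Λ) => ?_
  have hT' : T = (Λ'.map fun U => T * U).sum := by
    rw [Multiset.sum_map_mul_left, Multiset.map_id', h', mul_one]
  rw [SetLike.mem_coe, hT']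
  refine multiset_sum_mem _ fun U hU => ?_
  obtain ⟨V, hV, rfl⟩ := Multiset.mem_map.1 hU
  exact Algebra.subset_adjoin (Multiset.mem_map.2 ⟨(T, V), Multiset.mem_product.2 ⟨hT, hV⟩, rfl⟩)

theorem adjoin_le_adjoin_familyMul_right {Λ Λ' : Multiset (PairOp S)} (h : Λ.sum = 1) :
    Algebra.adjoin ℂ {T | T ∈ Λ'} ≤ Algebra.adjoin ℂ {T | T ∈ familyMul Λ Λ'} := by
  refine Algebra.adjoin_le fun T (hT : T ∈ Λ') => ?_
  have hT' : T = (Λ.map fun U => U * T).sum := by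
    rw [Multiset.sum_map_mul_right, Multiset.map_id', h, one_mul]
  rw [SetLike.mem_coe, hT']
  refine multiset_sum_mem _ fun U hU => ?_
  obtain ⟨V, hV, rfl⟩ := Multiset.mem_map.1 hU
  exact Algebra.subset_adjoin (Multiset.mem_map.2 ⟨(V, T), Multiset.mem_product.2 ⟨hV, hT⟩, rfl⟩)

variable [CommMonoid S]

theorem familyVariation_map {ι : Type*} [Fintype ι] (f : PairFun S) (R : ι → PairOp S) :
    familyVariation f (Finset.univ.val.map R) = ∑ i, ‖R i f (1, 1)‖ := by
  rw [familyVariation, Multiset.map_map]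
  rfl

/-- The variation grows under refinement, by the triangle inequality. -/
theorem familyVariation_le_familyMul (f : PairFun S) (Λ : Multiset (PairOp S))
    {Λ' : Multiset (PairOp S)} (h' : Λ'.sum = 1) :
    familyVariation f Λ ≤ familyVariation f (familyMul Λ Λ') := by
  obtain ⟨n, R, rfl⟩ := exists_eq_map_univ Λ
  obtain ⟨n', R', rfl⟩ := exists_eq_map_univ Λ'
  rw [sum_map_univ] at h'
  rw [familyMul_map, familyVariation_map, familyVariation_map, Fintype.sum_prod_type]
  refine Finset.sum_le_sum fun i _ => ?_
  have : R i f (1, 1) = ∑ j, (R i * R' j) f (1, 1) := by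
    conv_lhs => rw [← mul_one (R i), ← h', Finset.mul_sum]
    rw [LinearMap.sum_apply, Finset.sum_apply]
  rw [this]
  exact norm_sum_le _ _

/-- For a function of bounded variation, the variations over the whole of `Ω` are bounded: each is
at most the variation over a refinement beyond which the net stays near its limit. -/
theorem exists_familyVariation_le {f : PairFun S} (hf : IsMaserickBV f) :
    ∃ (τ : Set (PairOp S)) (Ω : Set (Multiset (PairOp S))), IsAdmissible τ ∧
      IsPartitionSystem τ Ω ∧ Ω.Nonempty ∧ ∃ C : ℝ, ∀ Λ ∈ Ω, familyVariation f Λ ≤ C := by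
  obtain ⟨τ, Ω, hτ, hΩ, L, hL⟩ := hf
  obtain ⟨Λ₀, hΛ₀, h⟩ := hL 1 one_pos
  refine ⟨τ, Ω, hτ, hΩ, ⟨Λ₀, hΛ₀⟩, L + 1, fun Λ hΛ => ?_⟩
  have h1 := h _ (hΩ.mul_mem Λ hΛ Λ₀ hΛ₀) ⟨Λ, hΛ, rfl⟩
  have h2 := familyVariation_le_familyMul f Λ (hΩ.sum_eq_one Λ₀ hΛ₀)
  linarith [(abs_lt.1 h1).2]

/-- Each element of `τ` belongs to some member of `Ω`, and products of members of `Ω` are common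
refinements; so every operator in the algebra of shifts is a polynomial in one partition. -/
theorem exists_mem_adjoin {τ : Set (PairOp S)} {Ω : Set (Multiset (PairOp S))}
    (hτ : IsAdmissible τ) (hΩ : IsPartitionSystem τ Ω) (hne : Ω.Nonempty) {T : PairOp S}
    (hT : T ∈ shiftAlgebra S) : ∃ Λ ∈ Ω, T ∈ Algebra.adjoin ℂ {U | U ∈ Λ} := by
  obtain ⟨Λ₀, hΛ₀⟩ := hne
  rw [← hτ.span_eq] at hT
  refine Submodule.span_induction
    (p := fun T _ => ∃ Λ ∈ Ω, T ∈ Algebra.adjoin ℂ {U | U ∈ Λ}) ?_ ?_ ?_ ?_ hT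
  · intro U hU
    refine Submonoid.closure_induction
      (motive := fun T _ => ∃ Λ ∈ Ω, T ∈ Algebra.adjoin ℂ {U | U ∈ Λ}) ?_ ?_ ?_ hU
    · intro V hV
      obtain ⟨Λ, hΛ, hVΛ⟩ := hΩ.cover V hV
      exact ⟨Λ, hΛ, Algebra.subset_adjoin hVΛ⟩
    · exact ⟨Λ₀, hΛ₀, one_mem _⟩
    · rintro V W _ _ ⟨Λ, hΛ, hV⟩ ⟨Λ', hΛ', hW⟩
      exact ⟨_, hΩ.mul_mem Λ hΛ Λ' hΛ',
        mul_mem (adjoin_le_adjoin_familyMul_left (hΩ.sum_eq_one _ hΛ') hV)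
          (adjoin_le_adjoin_familyMul_right (hΩ.sum_eq_one _ hΛ) hW)⟩
  · exact ⟨Λ₀, hΛ₀, zero_mem _⟩
  · rintro V W _ _ ⟨Λ, hΛ, hV⟩ ⟨Λ', hΛ', hW⟩
    exact ⟨_, hΩ.mul_mem Λ hΛ Λ' hΛ',
      add_mem (adjoin_le_adjoin_familyMul_left (hΩ.sum_eq_one _ hΛ') hV)
        (adjoin_le_adjoin_familyMul_right (hΩ.sum_eq_one _ hΛ) hW)⟩
  · rintro c V _ ⟨Λ, hΛ, hV⟩
    exact ⟨Λ, hΛ, Subalgebra.smul_mem _ hV c⟩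

/-- The powers of a partition `Λ ∈ Ω`, indexed by words, belong to `Ω`. -/
theorem wordFamily_mem {τ : Set (PairOp S)} {Ω : Set (Multiset (PairOp S))}
    (hΩ : IsPartitionSystem τ Ω) {ι : Type*} [Fintype ι] {r : ι → MonoidAlgebra ℂ (S × S)}
    (h : Finset.univ.val.map (fun i => shiftRep S (r i)) ∈ Ω) (N : ℕ) :
    Finset.univ.val.map (fun w : Fin (N + 1) → ι => shiftRep S (∏ j, r (w j))) ∈ Ω := by
  induction N with
  | zero =>
    convert h using 1
    rw [← Multiset.map_univ_val_equiv (Equiv.funUnique (Fin 1) ι), Multiset.map_map]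
    simp
  | succ N ih =>
    have := hΩ.mul_mem _ h _ ih
    rw [familyMul_map] at this
    rw [← Multiset.map_univ_val_equiv (Fin.consEquiv fun _ : Fin (N + 1 + 1) => ι),
      Multiset.map_map]
    convert this using 2
    simp [Fin.consEquiv, Fin.prod_univ_succ]

theorem hasWordVariationLE_evalFunctional {τ : Set (PairOp S)} {Ω : Set (Multiset (PairOp S))}
    (hΩ : IsPartitionSystem τ Ω) {f : PairFun S} {C : ℝ} (hC : ∀ Λ ∈ Ω, familyVariation f Λ ≤ C)
    {ι : Type*} [Fintype ι] {r : ι → MonoidAlgebra ℂ (S × S)}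
    (h : Finset.univ.val.map (fun i => shiftRep S (r i)) ∈ Ω) (hr : ∑ i, r i = 1) :
    HasWordVariationLE (evalFunctional f) r C := by
  have hsucc : ∀ N : ℕ, ∑ w : Fin (N + 1) → ι, ‖evalFunctional f (∏ j, r (w j))‖ ≤ C := by
    intro N
    have := hC _ (wordFamily_mem hΩ h N)
    rwa [familyVariation_map] at this
  intro N
  cases N with
  | succ N => exact hsucc N
  | zero =>
    -- The empty word contributes `‖L(1)‖`, which is at most the variation over words of length one.
    refine le_trans ?_ (hsucc 0)
    calc ∑ w : Fin 0 → ι, ‖evalFunctional f (∏ j, r (w j))‖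
        = ‖∑ w : Fin 1 → ι, evalFunctional f (∏ j, r (w j))‖ := by
          rw [← map_sum, ← Fintype.sum_pow, hr]
          simp
      _ ≤ _ := norm_sum_le _ _

/-- Conjugating the coefficients of a polynomial in self-adjoint operators gives the adjoint. -/
theorem shiftRep_aeval_map_conj {ι : Type*} {r : ι → MonoidAlgebra ℂ (S × S)}
    (hr : ∀ i, involOp (shiftRep S (r i)) = shiftRep S (r i)) (P : MvPolynomial ι ℂ) :
    shiftRep S (MvPolynomial.aeval r (MvPolynomial.map (starRingEnd ℂ) P)) =
      involOp (shiftRep S (MvPolynomial.aeval r P)) := by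
  induction P using MvPolynomial.induction_on with
  | C c =>
    simp only [MvPolynomial.map_C, MvPolynomial.aeval_C, Algebra.algebraMap_eq_smul_one, map_smul,
      map_one, involOp_smul, involOp_one]
  | add P Q hP hQ => simp only [map_add, involOp_add, hP, hQ]
  | mul_X P i hP =>
    simp only [map_mul, MvPolynomial.map_X, MvPolynomial.aeval_X, involOp_mul, hP, hr]

theorem shiftOp_mem_shiftAlgebra (a : S × S) : shiftOp a ∈ shiftAlgebra S :=
  Submodule.subset_span ⟨a, rfl⟩

/-- For a function `f` of bounded variation, any two elements `s`, `t` of `S` have their shifts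
expressed by polynomials in one finite partition of unity, along which `f` has bounded variation;
the adjoint shifts are given by the polynomials with conjugate coefficients. -/
theorem exists_partition_polynomials {f : PairFun S} (hf : IsMaserickBV f) (s t : S) :
    ∃ (n : ℕ) (r : Fin n → MonoidAlgebra ℂ (S × S)) (C : ℝ) (P Q : MvPolynomial (Fin n) ℂ),
      ∑ i, r i = 1 ∧ HasWordVariationLE (evalFunctional f) r C ∧
      MvPolynomial.aeval r P = MonoidAlgebra.of ℂ (S × S) (s, 1) ∧
      MvPolynomial.aeval r (MvPolynomial.map (starRingEnd ℂ) P) =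
        MonoidAlgebra.of ℂ (S × S) (1, s) ∧
      MvPolynomial.aeval r Q = MonoidAlgebra.of ℂ (S × S) (t, 1) ∧
      MvPolynomial.aeval r (MvPolynomial.map (starRingEnd ℂ) Q) =
        MonoidAlgebra.of ℂ (S × S) (1, t) := by
  obtain ⟨τ, Ω, hτ, hΩ, hne, C, hC⟩ := exists_familyVariation_le hf
  obtain ⟨Λ₁, hΛ₁, hs⟩ := exists_mem_adjoin hτ hΩ hne (shiftOp_mem_shiftAlgebra (s, 1))
  obtain ⟨Λ₂, hΛ₂, ht⟩ := exists_mem_adjoin hτ hΩ hne (shiftOp_mem_shiftAlgebra (t, 1))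
  have hΛ := hΩ.mul_mem Λ₁ hΛ₁ Λ₂ hΛ₂
  replace hs := adjoin_le_adjoin_familyMul_left (hΩ.sum_eq_one _ hΛ₂) hs
  replace ht := adjoin_le_adjoin_familyMul_right (hΩ.sum_eq_one _ hΛ₁) ht
  generalize familyMul Λ₁ Λ₂ = Λ at hΛ hs ht
  obtain ⟨n, R, rfl⟩ := exists_eq_map_univ Λ
  have hmem : ∀ i, R i ∈ positiveCone τ := fun i =>
    hΩ.mem_cone _ hΛ _ (Multiset.mem_map_of_mem R (Finset.mem_univ i))
  have hR : ∀ i, ∃ x, shiftRep S x = R i := fun i =>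
    mem_range_shiftRep (hτ.span_eq ▸ mem_span_closure_of_mem_positiveCone (hmem i))
  choose r hr using hR
  obtain rfl : (fun i => shiftRep S (r i)) = R := funext hr
  have hsum : ∑ i, r i = 1 := by
    apply shiftRep_injective
    rw [map_sum, map_one, ← hΩ.sum_eq_one _ hΛ, sum_map_univ]
  have hself : ∀ i, involOp (shiftRep S (r i)) = shiftRep S (r i) := fun i =>
    involOp_eq_of_mem_positiveCone hτ.invol_eq (hmem i)
  have hpoly : ∀ u : S,
      shiftOp (u, 1) ∈ Algebra.adjoin ℂ {T | T ∈ Finset.univ.val.map fun i => shiftRep S (r i)} →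
      ∃ P : MvPolynomial (Fin n) ℂ,
        MvPolynomial.aeval r P = MonoidAlgebra.of ℂ (S × S) (u, 1) ∧
        MvPolynomial.aeval r (MvPolynomial.map (starRingEnd ℂ) P) =
          MonoidAlgebra.of ℂ (S × S) (1, u) := by
    intro u hu
    have hle : Algebra.adjoin ℂ {T | T ∈ Finset.univ.val.map fun i => shiftRep S (r i)} ≤
        ((shiftRep S).comp (MvPolynomial.aeval r)).range := by
      refine Algebra.adjoin_le fun T (hT : T ∈ Finset.univ.val.map fun i => shiftRep S (r i)) => ?_
      obtain ⟨i, -, rfl⟩ := Multiset.mem_map.1 hT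
      exact ⟨MvPolynomial.X i, by simp⟩
    obtain ⟨P, hP⟩ := hle hu
    have hP' : shiftRep S (MvPolynomial.aeval r P) = shiftOp (u, 1) := hP
    refine ⟨P, shiftRep_injective ?_, shiftRep_injective ?_⟩
    · rw [hP', shiftRep_of]
    · rw [shiftRep_aeval_map_conj hself, hP', involOp_shiftOp, shiftRep_of, Prod.swap_prod_mk]
  obtain ⟨P, hP, hP'⟩ := hpoly s hs
  obtain ⟨Q, hQ, hQ'⟩ := hpoly t ht
  exact ⟨n, r, C, P, Q, hsum, hasWordVariationLE_evalFunctional hΩ hC hΛ hsum, hP, hP', hQ, hQ'⟩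

end Partitions

/-! ### Characters and the product formula -/

section PointMass

theorem realEval_map_conj {ι : Type*} (P : MvPolynomial ι ℂ) (x : ι → ℝ) :
    realEval (MvPolynomial.map (starRingEnd ℂ) P) x = conj (realEval P x) := by
  induction P using MvPolynomial.induction_on with
  | C c => simp [realEval]
  | add P Q hP hQ =>
    simp only [realEval, map_add] at hP hQ ⊢
    rw [hP, hQ]
  | mul_X P i hP =>
    simp only [realEval, map_mul, MvPolynomial.map_X, MvPolynomial.eval_X,
      Complex.conj_ofReal] at hP ⊢
    rw [hP]

theorem character_aeval_map_conj {ι A : Type*} [CommRing A] [Algebra ℂ A]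
    {χ : A →ₐ[ℂ] ℂ} {r : ι → A}
    (hχ : ∀ i, conj (χ (r i)) = χ (r i)) (P : MvPolynomial ι ℂ) :
    χ (MvPolynomial.aeval r (MvPolynomial.map (starRingEnd ℂ) P)) =
      conj (χ (MvPolynomial.aeval r P)) := by
  induction P using MvPolynomial.induction_on with
  | C c => simp
  | add P Q hP hQ => simp only [map_add, hP, hQ]
  | mul_X P i hP => simp only [map_mul, MvPolynomial.map_X, MvPolynomial.aeval_X, hP, hχ]

variable {ι : Type*} [Fintype ι] {A : Type*} [CommRing A] [Algebra ℂ A]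

/-- The rank-one theorem for an element `p` of the algebra and its adjoint `q`, obtained from the
Bernstein measures of the functional. -/
theorem map_sq_mul_map_one_eq_sq {L : A →ₗ[ℂ] ℂ} {r : ι → A} {C : ℝ} (hr : ∑ i, r i = 1)
    (hL : HasWordVariationLE L r C) (h1 : L 1 ≠ 0) {P : MvPolynomial ι ℂ} {p q : A}
    (hp : MvPolynomial.aeval r P = p)
    (hq : MvPolynomial.aeval r (MvPolynomial.map (starRingEnd ℂ) P) = q)
    (hpq : ∀ a b : ℕ, L (p ^ a * q ^ b) * L 1 = L (p ^ a) * L (q ^ b)) :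
    L (p ^ 2) * L 1 = L p ^ 2 := by
  classical
  obtain ⟨B, hB⟩ := (isCompact_Icc (a := (0 : ι → ℝ)) (b := 1)).exists_bound_of_continuousOn
    (continuous_realEval P).continuousOn
  let Λ : ℕ → ((ι → ℝ) → ℂ) →ₗ[ℂ] ℂ := fun N =>
    { toFun := bernsteinSum L r N
      map_add' := fun g h => by simp [bernsteinSum, mul_add, Finset.sum_add_distrib]
      map_smul' := fun c g => by
        simp only [bernsteinSum, Pi.smul_apply, smul_eq_mul, RingHom.id_apply, Finset.mul_sum]
        exact Finset.sum_congr rfl fun w _ => by ring }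
  have key := moment_two_mul_eq_sq (Λ := Λ) (C := C) (K := Set.Icc 0 1) (z := realEval P)
    (m := fun a b => L (p ^ a * q ^ b)) (fun N g δ _ hg => norm_bernsteinSum_le hL hg) hB ?_
    (by simpa using h1) (by simpa using hpq)
  · simpa using key
  · intro a b
    have hfun : realEval (P ^ a * MvPolynomial.map (starRingEnd ℂ) P ^ b) =
        fun x => realEval P x ^ a * conj (realEval P x) ^ b := by
      funext x
      rw [← realEval_map_conj]
      simp [realEval]
    have := tendsto_bernsteinSum hr (P ^ a * MvPolynomial.map (starRingEnd ℂ) P ^ b) L hL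
    rw [map_mul, map_pow, map_pow, hp, hq, hfun] at this
    exact this

/-- A multiple `c χ` of a character that has bounded variation along a partition of unity takes
real values on its members: the total variation of `χ` over words of length `N` is
`(∑ i, |χ(r i)|) ^ N`, so boundedness forces `∑ i, |χ(r i)| ≤ 1 = ∑ i, χ(r i)`. -/
theorem conj_character_eq_self {χ : A →ₐ[ℂ] ℂ} {c : ℂ} (hc : c ≠ 0) {L : A →ₗ[ℂ] ℂ}
    (hLχ : ∀ x, L x = c * χ x) {r : ι → A} {C : ℝ} (hr : ∑ i, r i = 1)
    (hL : HasWordVariationLE L r C) (i : ι) : conj (χ (r i)) = χ (r i) := by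
  have hpow : ∀ N : ℕ, ‖c‖ * (∑ i, ‖χ (r i)‖) ^ N ≤ C := by
    intro N
    refine le_trans (le_of_eq ?_) (hL N)
    rw [Fintype.sum_pow, Finset.mul_sum]
    refine Finset.sum_congr rfl fun w _ => ?_
    rw [hLχ, norm_mul, map_prod, norm_prod]
  have hle : ∑ i, ‖χ (r i)‖ ≤ 1 := by
    by_contra! hlt
    obtain ⟨N, hN⟩ := pow_unbounded_of_one_lt (C / ‖c‖) hlt
    rw [div_lt_iff₀' (norm_pos_iff.2 hc)] at hN
    exact absurd (hpow N) (not_le.2 hN)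
  have hone : ∑ i, (χ (r i)).re = 1 := by
    rw [← Complex.re_sum, ← map_sum, hr, map_one, Complex.one_re]
  have hsum : ∑ i, (χ (r i)).re = ∑ i, ‖χ (r i)‖ :=
    le_antisymm (Finset.sum_le_sum fun i _ => Complex.re_le_norm _) (hle.trans hone.ge)
  have heq := (Finset.sum_eq_sum_iff_of_le fun i _ => Complex.re_le_norm (χ (r i))).1 hsum i
    (Finset.mem_univ i)
  exact Complex.conj_eq_iff_im.2 (Complex.nonneg_iff.1 (Complex.re_eq_norm.1 heq)).2.symm

end PointMass

section ProductFormula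

variable {S : Type*} [CommMonoid S]

/-- The functional of `f` has rank one on the powers of `p = E_(s,e) + E_(t,e)` and of its adjoint,
and likewise for `E_(s,e)` and `E_(t,e)`; polarization of the resulting three squares shows that
`f(·,e)` and `f(e,·)` are multiplicative up to the factor `f(e,e)`. -/
theorem mul_apply_of_product_formula {f : PairFun S} (hf : IsMaserickBV f) (hf0 : f (1, 1) ≠ 0)
    (h : ∀ s t : S, f (1, 1) * f (s, t) = f (s, 1) * f (1, t)) (s t : S) :
    f (s * t, 1) * f (1, 1) = f (s, 1) * f (t, 1) ∧
      f (1, s * t) * f (1, 1) = f (1, s) * f (1, t) := by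
  obtain ⟨n, r, C, P, Q, hr, hL, hP, hP', hQ, hQ'⟩ := exists_partition_polynomials hf s t
  have hL1 := evalFunctional_one f
  have h1 : evalFunctional f 1 ≠ 0 := by rwa [hL1]
  have hrank : ∀ (x y : MonoidAlgebra ℂ S) (a b : ℕ),
      evalFunctional f (leftAlg S x ^ a * rightAlg S y ^ b) * evalFunctional f 1 =
        evalFunctional f (leftAlg S x ^ a) * evalFunctional f (rightAlg S y ^ b) := by
    intro x y a b
    rw [← map_pow, ← map_pow]
    exact evalFunctional_left_mul_right h _ _
  have hsq : ∀ (R : MvPolynomial (Fin n) ℂ) (x : MonoidAlgebra ℂ S),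
      MvPolynomial.aeval r R = leftAlg S x →
      MvPolynomial.aeval r (MvPolynomial.map (starRingEnd ℂ) R) = rightAlg S x →
      evalFunctional f (leftAlg S x ^ 2) * evalFunctional f 1 = evalFunctional f (leftAlg S x) ^ 2 ∧
      evalFunctional f (rightAlg S x ^ 2) * evalFunctional f 1 =
        evalFunctional f (rightAlg S x) ^ 2 := by
    intro R x hR hR'
    refine ⟨map_sq_mul_map_one_eq_sq hr hL h1 hR hR' (hrank x x),
      map_sq_mul_map_one_eq_sq hr hL h1 hR' (q := leftAlg S x) ?_ fun a b => ?_⟩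
    · rw [MvPolynomial.map_map, ← hR]
      simp [MvPolynomial.map_id]
    · rw [mul_comm (rightAlg S x ^ a), hrank, mul_comm]
  rw [← leftAlg_of] at hP hQ
  rw [← rightAlg_of] at hP' hQ'
  set x := MonoidAlgebra.of ℂ S s
  set y := MonoidAlgebra.of ℂ S t
  obtain ⟨hxl, hxr⟩ := hsq P x hP hP'
  obtain ⟨hyl, hyr⟩ := hsq Q y hQ hQ'
  obtain ⟨hzl, hzr⟩ := hsq (P + Q) (x + y) (by simp only [map_add, hP, hQ])
    (by simp only [map_add, hP', hQ'])
  have hexp : ∀ u v : MonoidAlgebra ℂ (S × S), evalFunctional f ((u + v) ^ 2) =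
      evalFunctional f (u ^ 2) + 2 * evalFunctional f (u * v) + evalFunctional f (v ^ 2) := by
    intro u v
    rw [add_sq, map_add, map_add, mul_assoc, two_mul, map_add, two_mul]
  rw [map_add (leftAlg S), hexp, map_add (evalFunctional f)] at hzl
  rw [map_add (rightAlg S), hexp, map_add (evalFunctional f)] at hzr
  have hl : evalFunctional f (leftAlg S x * leftAlg S y) * evalFunctional f 1 =
      evalFunctional f (leftAlg S x) * evalFunctional f (leftAlg S y) := by
    linear_combination (hzl - hxl - hyl) / 2
  have hr' : evalFunctional f (rightAlg S x * rightAlg S y) * evalFunctional f 1 =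
      evalFunctional f (rightAlg S x) * evalFunctional f (rightAlg S y) := by
    linear_combination (hzr - hxr - hyr) / 2
  simp only [x, y] at hl hr'
  rw [← map_mul (leftAlg S), ← map_mul (MonoidAlgebra.of ℂ S), leftAlg_of, leftAlg_of, leftAlg_of,
    evalFunctional_of, evalFunctional_of, evalFunctional_of, hL1] at hl
  rw [← map_mul (rightAlg S), ← map_mul (MonoidAlgebra.of ℂ S), rightAlg_of, rightAlg_of,
    rightAlg_of, evalFunctional_of, evalFunctional_of, evalFunctional_of, hL1] at hr'
  exact ⟨hl, hr'⟩

/-- The normalized function `f / f(e,e)` as a character of `S × S`. -/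
noncomputable def normalizedCharacter {f : PairFun S} (hf0 : f (1, 1) ≠ 0)
    (hmul : ∀ a b : S × S, f (a * b) * f (1, 1) = f a * f b) : S × S →* ℂ where
  toFun a := f a / f (1, 1)
  map_one' := div_self hf0
  map_mul' a b := by
    rw [div_mul_div_comm, ← hmul, mul_div_mul_right _ _ hf0]

/-- The two marginals of a function `f` of bounded variation that is multiplicative up to the
factor `f(e,e)` are conjugate to each other. -/
theorem apply_right_eq_conj_apply_left {f : PairFun S} (hf : IsMaserickBV f) (hf0 : f (1, 1) ≠ 0)
    (hmul : ∀ a b : S × S, f (a * b) * f (1, 1) = f a * f b) (t : S) :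
    f (1, t) / f (1, 1) = conj (f (t, 1) / f (1, 1)) := by
  obtain ⟨n, r, C, P, -, hr, hL, hP, hP', -⟩ := exists_partition_polynomials hf t t
  set χ := MonoidAlgebra.lift ℂ ℂ (S × S) (normalizedCharacter hf0 hmul) with hχ
  have hχof : ∀ a, χ (MonoidAlgebra.of ℂ _ a) = f a / f (1, 1) := by
    intro a
    rw [hχ, MonoidAlgebra.lift_of]
    rfl
  have hLχ : ∀ x, evalFunctional f x = f (1, 1) * χ x := by
    intro x
    induction x using MonoidAlgebra.induction_on with
    | of a => rw [evalFunctional_of, hχof, mul_div_cancel₀ _ hf0]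
    | add x y hx hy => rw [map_add, map_add, hx, hy, mul_add]
    | smul c x hx => rw [map_smul, map_smul, hx, smul_eq_mul, smul_eq_mul, mul_left_comm]
  have := character_aeval_map_conj (conj_character_eq_self hf0 hLχ hr hL) P
  rwa [hP, hP', hχof, hχof] at this

end ProductFormula

theorem mainTheorem8 {S : Type*} [CommMonoid S] (f : S × S → ℂ) (hf : IsMaserickBV f)
    (hf0 : f (1, 1) ≠ 0) :
    (∀ s t : S, f (1, 1) * f (s, t) = f (s, 1) * f (1, t)) ↔
      ∃ c : ℂ, c ≠ 0 ∧ ∃ γ ∈ multiplicativeFunctions S,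
        ∀ s t : S, f (s, t) = c * γ s * conj (γ t) := by
  constructor
  · intro h
    have hmarg := mul_apply_of_product_formula hf hf0 h
    have hmul : ∀ a b : S × S, f (a * b) * f (1, 1) = f a * f b := by
      rintro ⟨s, t⟩ ⟨u, v⟩
      rw [Prod.mk_mul_mk]
      refine mul_right_cancel₀ (pow_ne_zero 2 hf0) ?_
      linear_combination f (1, 1) ^ 2 * h (s * u) (t * v) - f (1, 1) * f (u, v) * h s t -
        f (s, 1) * f (1, t) * h u v + f (1, t * v) * f (1, 1) * (hmarg s u).1 +
        f (s, 1) * f (u, 1) * (hmarg t v).2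
    refine ⟨f (1, 1), hf0, fun s => f (s, 1) / f (1, 1), ⟨fun h0 => ?_, fun s t => ?_⟩,
      fun s t => ?_⟩
    · have := congrFun h0 1
      rw [div_self hf0] at this
      exact one_ne_zero this
    · have := (hmarg s t).1
      field_simp
      exact this
    · rw [← apply_right_eq_conj_apply_left hf hf0 hmul]
      field_simp
      rw [← h]
      ring
  · rintro ⟨c, -, γ, -, hγ⟩ s t
    simp only [hγ]
    ring
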